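/- Let $\mathsf{HA}^-$ be the category whose objects are the Heyting algebras (bounded distributive lattices $A$ in which for all $a,b\in A$ there is an element $a\to b$ with $a\wedge c\le b \iff c\le a\to b$ for all $c \in A$) and whose morphisms are the bounded lattice homomorphisms. For a frame $L$ (a complete lattice with $a\wedge\bigvee S=\bigvee\{a\wedge s: s\in S\}$ for all $a \in L$ and $S \subseteq L$) let $K(L)$ be the set of its compact elements, where $a \in L$ is compact if $a\le\bigvee S$ implies $a\le\bigvee T$ for some finite $T\subseteq S$. The frame $L$ is coherent if each element of $L$ is a join of compact elements and $K(L)$ is a bounded sublattice of $L$. A Heyting frame is a coherent frame $L$ such that $K(L)$ is a Heyting subalgebra of $L$, that is, $K(L)$ is moreover closed under the implication of $L$. Let $\mathsf{HeytFrm}^-$ be the category whose objects are the Heyting frames and whose morphisms are the coherent frame homomorphisms, that is, the maps that preserve finite meets, arbitrary joins, and compactness of elements. An Esakia space is a partially ordered set $X$ with a compact topology such that whenever $x\not\le y$ there is a clopen upset $U$ with $x\in U$ and $y\notin U$, and such that ${\downarrow}U=\{x : x\le u \text{ for some } u\in U\}$ is clopen for each clopen $U \subseteq X$. Let $\mathsf{ES}^-$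 be the category whose objects are the Esakia spaces and whose morphisms are the Priestley morphisms, that is, the continuous order-preserving maps. **Theorem.** The categories $\mathsf{HA}^-$ and $\mathsf{HeytFrm}^-$ are equivalent, and each of them is dually equivalent to $\mathsf{ES}^-$. -/

import Mathlib

open CategoryTheory

universe u

/-! ### Heyting algebras with bounded lattice homomorphisms -/

/-- The category of Heyting algebras and bounded lattice homomorphisms, that is, the full
subcategory of the category of bounded distributive lattices on the Heyting algebras. -/
abbrev HAMinus : Type (u + 1) :=
  InducedCategory BddDistLat.{u} (fun A : HeytAlg.{u} => BddDistLat.of A)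

/-! ### Heyting frames with coherent frame homomorphisms -/

/-- The set `K(L)` of compact elements of a complete lattice. -/
def compactElements (L : Type*) [CompleteLattice L] : Set L := {a | IsCompactElement a}

/-- `S` is (the carrier of) a bounded sublattice. -/
structure IsBoundedSublattice {L : Type*} [Lattice L] [BoundedOrder L] (S : Set L) : Prop where
  bot_mem : ⊥ ∈ S
  top_mem : ⊤ ∈ S
  sup_mem : ∀ a ∈ S, ∀ b ∈ S, a ⊔ b ∈ S
  inf_mem : ∀ a ∈ S, ∀ b ∈ S, a ⊓ b ∈ S

/-- `S` is (the carrier of) a Heyting subalgebra. -/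
structure IsHeytingSubalgebra {A : Type*} [HeytingAlgebra A] (S : Set A) : Prop
    extends IsBoundedSublattice S where
  himp_mem : ∀ a ∈ S, ∀ b ∈ S, a ⇨ b ∈ S

/-- A coherent frame: every element is a join of compact elements, and the compact elements form
a bounded sublattice. -/
class IsCoherentFrame (L : Type*) [Order.Frame L] : Prop extends IsCompactlyGenerated L where
  isBoundedSublattice : IsBoundedSublattice (compactElements L)

/-- A Heyting frame: a coherent frame `L` whose compact elements form a Heyting subalgebra
of `L`. -/
class IsHeytingFrame (L : Type*) [Order.Frame L] : Prop extends IsCoherentFrame L where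
  isHeytingSubalgebra : IsHeytingSubalgebra (compactElements L)

/-- A coherent frame homomorphism: a map that preserves finite meets, arbitrary joins, and
compactness of elements. -/
@[ext]
structure CoherentFrameHom (L M : Type*) [Order.Frame L] [Order.Frame M] where
  /-- The underlying frame homomorphism. -/
  toFrameHom : FrameHom L M
  map_compact : ∀ a ∈ compactElements L, toFrameHom a ∈ compactElements M

/-- The identity. -/
def CoherentFrameHom.id (L : Type*) [Order.Frame L] : CoherentFrameHom L L where
  toFrameHom := FrameHom.id L
  map_compact _ ha := ha

/-- Composition of maps. -/
def CoherentFrameHom.comp {L M N : Type*} [Order.Frame L] [Order.Frame M] [Order.Frame N]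
    (g : CoherentFrameHom M N) (f : CoherentFrameHom L M) : CoherentFrameHom L N where
  toFrameHom := g.toFrameHom.comp f.toFrameHom
  map_compact a ha := g.map_compact _ (f.map_compact a ha)

/-- The type of Heyting frames, the objects of the category of Heyting frames and coherent frame
homomorphisms. -/
structure HeytFrmMinus : Type (u + 1) where
  /-- The underlying type. -/
  carrier : Type u
  [frame : Order.Frame carrier]
  [isHeytingFrame : IsHeytingFrame carrier]

attribute [instance] HeytFrmMinus.frame HeytFrmMinus.isHeytingFrame

/-- The category of Heyting frames and coherent frame homomorphisms. -/
instance : Category.{u} HeytFrmMinus.{u} where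
  Hom L M := CoherentFrameHom L.carrier M.carrier
  id L := CoherentFrameHom.id L.carrier
  comp f g := g.comp f

/-! ### Esakia spaces with Priestley morphisms -/

/-- An Esakia space: a partially ordered set with a compact topology such that the Priestley
separation axiom holds and the down-closure of each clopen set is clopen. -/
class IsEsakiaSpace (X : Type*) [PartialOrder X] [TopologicalSpace X] : Prop
    extends CompactSpace X, PriestleySpace X where
  isClopen_lowerClosure : ∀ U : Set X, IsClopen U → IsClopen (lowerClosure U : Set X)

/-- The type of Esakia spaces, the objects of the category of Esakia spaces and Priestley
morphisms. -/
structure ESMinus : Type (u + 1) where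
  /-- The underlying type. -/
  carrier : Type u
  [partialOrder : PartialOrder carrier]
  [topologicalSpace : TopologicalSpace carrier]
  [isEsakiaSpace : IsEsakiaSpace carrier]

attribute [instance] ESMinus.partialOrder ESMinus.topologicalSpace ESMinus.isEsakiaSpace

/-- The category of Esakia spaces and Priestley morphisms, that is, continuous order-preserving
maps. -/
instance : Category.{u} ESMinus.{u} where
  Hom X Y := X.carrier →Co Y.carrier
  id X := ContinuousOrderHom.id X.carrier
  comp f g := g.comp f

/-!
Two functors into the category of Heyting algebras and bounded lattice homomorphisms are shown to
be fully faithful and essentially surjective; the three equivalences follow from them.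

The first sends a Heyting frame `L` to the Heyting algebra of its compact elements. A coherent
frame homomorphism is determined by its values on compact elements, of which every element is a
join. Conversely, a bounded lattice homomorphism `h` between compact elements extends to the map
that sends `a` to the join of the `h c` over the compact `c ≤ a`; this map has a right adjoint
(`CoherentFrameHom.gc_extendFun`), hence preserves all joins. A Heyting algebra `A` is recovered
from its frame of ideals, whose compact elements are the principal ideals
(`Order.Ideal.principalOrderIso`).

The second, contravariant, sends an Esakia space to the Heyting algebra of its clopen upsets. Since
clopen upsets separate points, a Priestley morphism is determined by the preimages of clopen
upsets. Conversely, given a bounded lattice homomorphism `h` from the clopen upsets of `Y` to those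
of `X`, each `x : X` gives a prime filter `{U | x ∈ h U}`, which is that of a point of `Y` by
compactness (`ClopenUpperSet.exists_point`); this defines a Priestley morphism that induces `h`. A
Heyting algebra `A` is recovered from its space of prime filters: by the prime filter theorem and
compactness `a ↦ {p | a ∈ p}` is an isomorphism from `A` to the clopen upsets
(`LatticeSpectrum.basicClopenOrderIso`), and the down-closure of `{p | a ∈ p} \ {p | b ∈ p}` is the
complement of `{p | a ⇨ b ∈ p}` (`LatticeSpectrum.lowerClosure_basicClopen_diff`), so that the space
is an Esakia space.
-/

/-! ### Morphisms of Heyting algebras -/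

/-- A bounded lattice homomorphism, as a morphism of `HAMinus`. -/
def HAMinus.homOf {A B : HeytAlg.{u}} (f : BoundedLatticeHom A B) :
    (show HAMinus.{u} from A) ⟶ (show HAMinus.{u} from B) :=
  InducedCategory.homMk (BddDistLat.ofHom f)

/-- An order isomorphism of Heyting algebras, as an isomorphism of `HAMinus`. -/
def HAMinus.isoOfOrderIso {A B : HeytAlg.{u}} (e : A ≃o B) :
    (show HAMinus.{u} from A) ≅ (show HAMinus.{u} from B) :=
  InducedCategory.isoMk
    { hom := BddDistLat.ofHom (e : BoundedLatticeHom A B)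
      inv := BddDistLat.ofHom (e.symm : BoundedLatticeHom B A)
      hom_inv_id := by ext x; exact e.symm_apply_apply x
      inv_hom_id := by ext x; exact e.apply_symm_apply x }

/-! ### The compact elements of a Heyting frame -/

section Compacts

open CompleteLattice

variable {L M : Type*} [Order.Frame L] [Order.Frame M]

section
variable [IsHeytingFrame L]

instance : Max (compactElements L) :=
  ⟨fun a b => ⟨a ⊔ b, IsHeytingFrame.isHeytingSubalgebra.sup_mem _ a.2 _ b.2⟩⟩

instance : Min (compactElements L) :=
  ⟨fun a b => ⟨a ⊓ b, IsHeytingFrame.isHeytingSubalgebra.inf_mem _ a.2 _ b.2⟩⟩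

instance : Top (compactElements L) := ⟨⟨⊤, IsHeytingFrame.isHeytingSubalgebra.top_mem⟩⟩

instance : Bot (compactElements L) := ⟨⟨⊥, IsHeytingFrame.isHeytingSubalgebra.bot_mem⟩⟩

instance : HImp (compactElements L) :=
  ⟨fun a b => ⟨a ⇨ b, IsHeytingFrame.isHeytingSubalgebra.himp_mem _ a.2 _ b.2⟩⟩

instance : Compl (compactElements L) := ⟨fun a => a ⇨ ⊥⟩

/-- The compact elements of a Heyting frame, with the operations of the frame. -/
instance : HeytingAlgebra (compactElements L) :=
  Subtype.val_injective.heytingAlgebra _ .rfl .rfl (fun _ _ => rfl) (fun _ _ => rfl) rfl rfl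
    (fun a => himp_bot a.1) (fun _ _ => rfl)

end

namespace CoherentFrameHom

/-- The restriction of a coherent frame homomorphism to compact elements. -/
def restrict [IsHeytingFrame L] [IsHeytingFrame M] (f : CoherentFrameHom L M) :
    BoundedLatticeHom (compactElements L) (compactElements M) where
  toFun a := ⟨f.toFrameHom a, f.map_compact a a.2⟩
  map_sup' a b := Subtype.ext (map_sup f.toFrameHom a.1 b.1)
  map_inf' a b := Subtype.ext (map_inf f.toFrameHom a.1 b.1)
  map_top' := Subtype.ext (map_top f.toFrameHom)
  map_bot' := Subtype.ext (map_bot f.toFrameHom)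

/-- Faithfulness: each element of a coherent frame is a join of compact elements. -/
theorem restrict_injective [IsHeytingFrame L] [IsHeytingFrame M] :
    Function.Injective (restrict : CoherentFrameHom L M → _) := by
  intro f g h
  have key : ∀ c ∈ compactElements L, f.toFrameHom c = g.toFrameHom c := fun c hc =>
    congrArg Subtype.val (DFunLike.congr_fun h (⟨c, hc⟩ : compactElements L))
  ext a
  rw [← sSup_compact_le_eq a, map_sSup, map_sSup]
  exact congrArg sSup (Set.image_congr fun c hc => key c hc.1)

section Extend

variable [IsHeytingFrame L] [IsHeytingFrame M]
  (h : BoundedLatticeHom (compactElements L) (compactElements M))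

/-- The extension of a lattice homomorphism between compact elements: `a` is sent to the join of
the images of the compact elements below `a`. -/
def extendFun (a : L) : M :=
  ⨆ c : {c : compactElements L // (c : L) ≤ a}, (h c : M)

theorem le_extendFun {a : L} (c : compactElements L) (hc : (c : L) ≤ a) :
    (h c : M) ≤ extendFun h a :=
  le_iSup (fun c : {c : compactElements L // (c : L) ≤ a} => (h c : M)) ⟨c, hc⟩

theorem extendFun_coe (c : compactElements L) : extendFun h c = h c :=
  le_antisymm (iSup_le fun d => OrderHomClass.mono h (show d.1 ≤ c from d.2))
    (le_extendFun h c le_rfl)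

/-- The right adjoint of `extendFun h`. -/
def extendAdjoint (b : M) : L :=
  sSup (Subtype.val '' {c : compactElements L | (h c : M) ≤ b})

/-- The adjunction through which `extendFun h` preserves arbitrary joins. -/
theorem gc_extendFun : GaloisConnection (extendFun h) (extendAdjoint h) := by
  intro a b
  constructor
  · intro hab
    rw [← sSup_compact_le_eq a]
    refine sSup_le fun c hc => le_sSup ⟨⟨c, hc.1⟩, ?_, rfl⟩
    exact (le_extendFun h ⟨c, hc.1⟩ hc.2).trans hab
  · intro hab
    refine iSup_le fun c => ?_
    -- The compact elements sent below `b` are directed, so a compact element below their join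
    -- is below one of them.
    obtain ⟨-, ⟨d, hd, rfl⟩, hcd⟩ :=
      (isCompactElement_iff_le_of_directed_sSup_le L (c.1 : L)).1 c.1.2
        (Subtype.val '' {c : compactElements L | (h c : M) ≤ b})
        ⟨_, ⊥, by simp [show ((⊥ : compactElements M) : M) = ⊥ from rfl], rfl⟩
        (by
          rintro - ⟨x, hx, rfl⟩ - ⟨y, hy, rfl⟩
          refine ⟨_, ⟨x ⊔ y, ?_, rfl⟩, le_sup_left, le_sup_right⟩
          rw [Set.mem_ofPred_eq, map_sup]
          exact sup_le hx hy)
        (c.2.trans hab)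
    exact (show (h c : M) ≤ h d from OrderHomClass.mono h (show c.1 ≤ d from hcd)).trans hd

/-- The coherent frame homomorphism that restricts to `h` on compact elements. -/
def extend : CoherentFrameHom L M where
  toFrameHom :=
    { toFun := extendFun h
      map_inf' := fun a b => by
        refine le_antisymm (le_inf ((gc_extendFun h).monotone_l inf_le_left)
          ((gc_extendFun h).monotone_l inf_le_right)) ?_
        rw [extendFun, extendFun, iSup_inf_iSup]
        refine iSup_le fun p => ?_
        have := le_extendFun h (a := a ⊓ b) (p.1.1 ⊓ p.2.1) (inf_le_inf p.1.2 p.2.2)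
        rwa [map_inf] at this
      map_top' := by
        refine top_le_iff.1 ?_
        have := le_extendFun h (a := ⊤) ⊤ le_rfl
        rwa [map_top] at this
      map_sSup' := fun s => by
        rw [sSup_image]
        exact (gc_extendFun h).l_sSup }
  map_compact a ha := by
    change extendFun h a ∈ _
    exact (extendFun_coe h ⟨a, ha⟩).symm ▸ (h ⟨a, ha⟩).2

theorem restrict_extend : (extend h).restrict = h :=
  BoundedLatticeHom.ext fun c => Subtype.ext (extendFun_coe h c)

end Extend

end CoherentFrameHom

/-- The functor that sends a Heyting frame to the Heyting algebra of its compact elements. -/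
def compactElementsFunctor : HeytFrmMinus.{u} ⥤ HAMinus.{u} where
  obj L := HeytAlg.of (compactElements L.carrier)
  map f := HAMinus.homOf (CoherentFrameHom.restrict f)

instance : compactElementsFunctor.{u}.Faithful where
  map_injective {L M _ _} h := CoherentFrameHom.restrict_injective
    (congrArg (fun k : compactElementsFunctor.obj L ⟶ compactElementsFunctor.obj M => k.hom.hom) h)

instance : compactElementsFunctor.{u}.Full where
  map_surjective g := ⟨CoherentFrameHom.extend g.hom.hom,
    InducedCategory.hom_ext (BddDistLat.ext fun x =>
      DFunLike.congr_fun (CoherentFrameHom.restrict_extend g.hom.hom) x)⟩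

end Compacts

/-! ### The frame of ideals of a Heyting algebra -/

namespace Order.Ideal

variable {A : Type*}

section DistribLattice

variable [DistribLattice A] [BoundedOrder A]

/-- The implication of ideals: `a` belongs to it when `a ⊓ b ∈ J` for each `b ∈ I`. -/
def himp (I J : Ideal A) : Ideal A where
  carrier := {a | ∀ b ∈ I, a ⊓ b ∈ J}
  lower' a b hba ha c hc := J.lower (inf_le_inf_right c hba) (ha c hc)
  nonempty' := ⟨⊥, fun b _ => by simp⟩
  directed' a ha b hb := ⟨a ⊔ b, fun c hc => by
    rw [inf_sup_right]; exact sup_mem (ha c hc) (hb c hc), le_sup_left, le_sup_right⟩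

theorem le_himp {I J K : Ideal A} : I ≤ himp J K ↔ I ⊓ J ≤ K :=
  ⟨fun h _ ha => by simpa using h ha.1 _ ha.2,
    fun h _ ha b hb => h ⟨I.lower inf_le_left ha, J.lower inf_le_right hb⟩⟩

/-- The ideals of a bounded distributive lattice form a frame. -/
instance : _root_.Order.Frame (Ideal A) where
  himp := himp
  le_himp_iff _ _ _ := le_himp
  compl I := himp I ⊥
  himp_bot _ := rfl

/-- A directed join of ideals is their union. -/
theorem mem_sSup_of_directedOn {S : Set (Ideal A)} (hne : S.Nonempty)
    (hS : DirectedOn (· ≤ ·) S) {a : A} (ha : a ∈ sSup S) : ∃ I ∈ S, a ∈ I := by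
  have hid : IsIdeal (⋃₀ (SetLike.coe '' S) : Set A) := by
    refine isIdeal_sUnion_of_directedOn ?_ ?_ (hne.image _)
    · rintro - ⟨I, -, rfl⟩
      exact I.isIdeal
    · rintro - ⟨I, hI, rfl⟩ - ⟨J, hJ, rfl⟩
      obtain ⟨K, hK, hIK, hJK⟩ := hS I hI J hJ
      exact ⟨K, ⟨K, hK, rfl⟩, hIK, hJK⟩
  have hle : sSup S ≤ hid.toIdeal := sSup_le fun I hI a ha => ⟨I, ⟨I, hI, rfl⟩, ha⟩
  obtain ⟨-, ⟨I, hI, rfl⟩, haI⟩ := hle ha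
  exact ⟨I, hI, haI⟩

theorem isCompactElement_principal (a : A) : IsCompactElement (principal a) := by
  rw [CompleteLattice.isCompactElement_iff_le_of_directed_sSup_le]
  intro S hne hS ha
  simpa using mem_sSup_of_directedOn hne hS (principal_le_iff.1 ha)

theorem sSup_image_principal (I : Ideal A) : sSup (principal '' (I : Set A)) = I :=
  le_antisymm (sSup_le (by rintro - ⟨a, ha, rfl⟩; exact principal_le_iff.2 ha))
    fun a ha => principal_le_iff.1 (le_sSup ⟨a, ha, rfl⟩)

theorem isCompactElement_iff_exists_principal {I : Ideal A} :
    IsCompactElement I ↔ ∃ a, principal a = I := by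
  refine ⟨fun hI => ?_, by rintro ⟨a, rfl⟩; exact isCompactElement_principal a⟩
  obtain ⟨-, ⟨a, ha, rfl⟩, hle⟩ :=
    (CompleteLattice.isCompactElement_iff_le_of_directed_sSup_le _ I).1 hI
      (principal '' (I : Set A)) (I.nonempty.image _)
      (by
        rintro - ⟨a, ha, rfl⟩ - ⟨b, hb, rfl⟩
        exact ⟨_, ⟨a ⊔ b, sup_mem ha hb, rfl⟩, by simp, by simp⟩)
      (sSup_image_principal I).ge
  exact ⟨a, le_antisymm (principal_le_iff.2 ha) hle⟩

theorem principal_sup_principal (a b : A) : principal a ⊔ principal b = principal (a ⊔ b) := by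
  refine le_antisymm (by simp) (principal_le_iff.2 (sup_mem ?_ ?_))
  · exact le_sup_left (b := principal b) (mem_principal_self (x := a))
  · exact le_sup_right (a := principal a) (mem_principal_self (x := b))

theorem principal_inf_principal (a b : A) : principal a ⊓ principal b = principal (a ⊓ b) := by
  ext c; simp

end DistribLattice

section Heyting

variable [HeytingAlgebra A]

theorem principal_himp_principal (a b : A) : (principal a ⇨ principal b) = principal (a ⇨ b) := by
  refine eq_of_forall_le_iff fun I => ?_
  rw [le_himp_iff]
  constructor
  · exact fun h c hc => le_himp_iff.2 (h ⟨I.lower inf_le_left hc, inf_le_right⟩)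
  · exact fun h c hc => (le_inf le_rfl hc.2).trans (le_himp_iff.1 (h hc.1))

theorem isHeytingSubalgebra_compactElements :
    IsHeytingSubalgebra (compactElements (Ideal A)) where
  bot_mem := isCompactElement_iff_exists_principal.2 ⟨⊥, principal_bot⟩
  top_mem := isCompactElement_iff_exists_principal.2 ⟨⊤, principal_top⟩
  sup_mem I hI J hJ := by
    obtain ⟨a, rfl⟩ := isCompactElement_iff_exists_principal.1 hI
    obtain ⟨b, rfl⟩ := isCompactElement_iff_exists_principal.1 hJ
    exact isCompactElement_iff_exists_principal.2 ⟨_, (principal_sup_principal a b).symm⟩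
  inf_mem I hI J hJ := by
    obtain ⟨a, rfl⟩ := isCompactElement_iff_exists_principal.1 hI
    obtain ⟨b, rfl⟩ := isCompactElement_iff_exists_principal.1 hJ
    exact isCompactElement_iff_exists_principal.2 ⟨_, (principal_inf_principal a b).symm⟩
  himp_mem I hI J hJ := by
    obtain ⟨a, rfl⟩ := isCompactElement_iff_exists_principal.1 hI
    obtain ⟨b, rfl⟩ := isCompactElement_iff_exists_principal.1 hJ
    exact isCompactElement_iff_exists_principal.2 ⟨_, (principal_himp_principal a b).symm⟩

/-- The ideals of a Heyting algebra form a Heyting frame. -/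
instance : IsHeytingFrame (Ideal A) where
  exists_sSup_eq I := ⟨principal '' (I : Set A),
    by rintro - ⟨a, -, rfl⟩; exact isCompactElement_principal a, sSup_image_principal I⟩
  isBoundedSublattice := isHeytingSubalgebra_compactElements.toIsBoundedSublattice
  isHeytingSubalgebra := isHeytingSubalgebra_compactElements

/-- A Heyting algebra is isomorphic to the compact elements of its frame of ideals. -/
noncomputable def principalOrderIso : A ≃o compactElements (Ideal A) :=
  RelIso.ofSurjective
    (OrderEmbedding.ofMapLEIff (fun a => ⟨principal a, isCompactElement_principal a⟩)
      fun a b => (principal_le_iff.trans mem_principal : principal a ≤ principal b ↔ a ≤ b))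
    fun I => by
      obtain ⟨a, ha⟩ := isCompactElement_iff_exists_principal.1 I.2
      exact ⟨a, Subtype.ext ha⟩

end Heyting

end Order.Ideal

instance : compactElementsFunctor.{u}.EssSurj where
  mem_essImage (A : HeytAlg.{u}) := ⟨⟨Order.Ideal A⟩,
    ⟨(HAMinus.isoOfOrderIso (B := HeytAlg.of (compactElements (Order.Ideal A)))
      Order.Ideal.principalOrderIso).symm⟩⟩

instance : compactElementsFunctor.{u}.IsEquivalence where

/-! ### Clopen sets of compact spaces -/

section Separation

variable {X : Type*} [TopologicalSpace X] [CompactSpace X] {B : Set (Set X)} {C : Set X}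

/-- In a compact space, a clopen set belongs to each bounded sublattice of clopen sets that
separates its points from the points outside it. -/
theorem IsBoundedSublattice.mem_of_isClopen (hB : IsBoundedSublattice B)
    (hBc : ∀ U ∈ B, IsClopen U) (hC : IsClopen C)
    (hsep : ∀ x ∈ C, ∀ y ∉ C, ∃ U ∈ B, x ∈ U ∧ y ∉ U) : C ∈ B := by
  -- Two compactness arguments: finite intersections for a fixed `x ∈ C`, then finite unions.
  have hpt : ∀ x ∈ C, ∃ U ∈ B, x ∈ U ∧ U ⊆ C := by
    intro x hx
    have := hC.compl.isClosed.isCompact.induction_on (p := fun s => ∃ U ∈ B, x ∈ U ∧ U ⊆ sᶜ)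
      ⟨⊤, hB.top_mem, trivial, by simp⟩
      (fun s t hst ⟨U, hU, hxU, hUt⟩ =>
        ⟨U, hU, hxU, hUt.trans (Set.compl_subset_compl.2 hst)⟩)
      (fun s t ⟨U, hU, hxU, hUs⟩ ⟨V, hV, hxV, hVt⟩ =>
        ⟨U ⊓ V, hB.inf_mem U hU V hV, ⟨hxU, hxV⟩, by
          rw [Set.compl_union]; exact Set.inter_subset_inter hUs hVt⟩)
      (fun y hy => by
        obtain ⟨U, hU, hxU, hyU⟩ := hsep x hx y hy
        exact ⟨Uᶜ, mem_nhdsWithin_of_mem_nhds ((hBc U hU).compl.isOpen.mem_nhds hyU),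
          U, hU, hxU, (compl_compl U).ge⟩)
    simpa using this
  obtain ⟨U, hU, hCU, hUC⟩ := hC.isClosed.isCompact.induction_on
    (p := fun s => ∃ U ∈ B, s ⊆ U ∧ U ⊆ C)
    ⟨⊥, hB.bot_mem, Set.empty_subset _, Set.empty_subset _⟩
    (fun s t hst ⟨U, hU, htU, hUC⟩ => ⟨U, hU, hst.trans htU, hUC⟩)
    (fun s t ⟨U, hU, hsU, hUC⟩ ⟨V, hV, htV, hVC⟩ =>
      ⟨U ⊔ V, hB.sup_mem U hU V hV, Set.union_subset_union hsU htV, Set.union_subset hUC hVC⟩)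
    (fun x hx => by
      obtain ⟨U, hU, hxU, hUC⟩ := hpt x hx
      exact ⟨U, mem_nhdsWithin_of_mem_nhds ((hBc U hU).isOpen.mem_nhds hxU), U, hU,
        subset_rfl, hUC⟩)
  rwa [hCU.antisymm hUC]

/-- In a compact ordered space, a family of clopen sets that separates `x` from `y` whenever
`¬x ≤ y` generates the Boolean algebra of clopen sets. -/
theorem IsClopen.mem_booleanClosure [PartialOrder X] (hC : IsClopen C) (hBc : ∀ U ∈ B, IsClopen U)
    (hsep : ∀ x y, ¬x ≤ y → ∃ U ∈ B, x ∈ U ∧ y ∉ U) : C ∈ BooleanSubalgebra.closure B := by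
  have hL : IsBoundedSublattice (BooleanSubalgebra.closure B : Set (Set X)) :=
    ⟨BooleanSubalgebra.bot_mem, BooleanSubalgebra.top_mem,
      fun _ ha _ hb => BooleanSubalgebra.sup_mem ha hb,
      fun _ ha _ hb => BooleanSubalgebra.inf_mem ha hb⟩
  refine hL.mem_of_isClopen (fun U hU => ?_) hC fun x hx y hy => ?_
  · induction hU using BooleanSubalgebra.closure_bot_sup_induction with
    | mem U hU => exact hBc U hU
    | bot => exact isClopen_empty
    | sup U _ V _ hU hV => exact hU.union hV
    | compl U _ hU => exact hU.compl
  · obtain hxy | hyx := (show x ≠ y from fun h => hy (h ▸ hx)).not_le_or_not_ge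
    · obtain ⟨U, hU, hxU, hyU⟩ := hsep x y hxy
      exact ⟨U, BooleanSubalgebra.mem_closure_of_mem hU, hxU, hyU⟩
    · obtain ⟨U, hU, hyU, hxU⟩ := hsep y x hyx
      exact ⟨Uᶜ, BooleanSubalgebra.compl_mem (BooleanSubalgebra.mem_closure_of_mem hU), hxU,
        fun h => h hyU⟩

end Separation

/-! ### The clopen upsets of an Esakia space -/

namespace ClopenUpperSet

variable {X Y : Type*} [PartialOrder X] [TopologicalSpace X] [PartialOrder Y] [TopologicalSpace Y]

theorem exists_mem_notMem [PriestleySpace X] {x y : X} (h : ¬x ≤ y) :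
    ∃ U : ClopenUpperSet X, x ∈ U ∧ y ∉ U := by
  obtain ⟨U, hU, hU', hx, hy⟩ := exists_isClopen_upper_of_not_le h
  exact ⟨⟨⟨U, hU⟩, hU'⟩, hx, hy⟩

theorem le_iff_forall_mem [PriestleySpace X] {x y : X} :
    x ≤ y ↔ ∀ U : ClopenUpperSet X, x ∈ U → y ∈ U := by
  refine ⟨fun h U hx => U.upper h hx, fun h => ?_⟩
  by_contra hxy
  obtain ⟨U, hx, hy⟩ := exists_mem_notMem hxy
  exact hy (h U hx)

/-- The clopen upsets of an Esakia space form a Heyting algebra: `U ⇨ V` is the complement of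
the down-closure of `U \ V`. -/
instance [IsEsakiaSpace X] : HeytingAlgebra (ClopenUpperSet X) where
  himp U V := ⟨⟨(lowerClosure (U \ V : Set X) : Set X)ᶜ,
    (IsEsakiaSpace.isClopen_lowerClosure _ (U.isClopen.diff V.isClopen)).compl⟩,
    (lowerClosure (U \ V : Set X)).lower.compl⟩
  le_himp_iff W U V := by
    constructor
    · intro h x hx
      by_contra hxV
      exact h hx.1 (subset_lowerClosure ⟨hx.2, hxV⟩)
    · rintro h x hx ⟨y, hy, hxy⟩
      exact hy.2 (h ⟨W.upper hxy hx, hy.1⟩)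
  compl U := ⟨⟨(lowerClosure (U \ (⊥ : ClopenUpperSet X) : Set X) : Set X)ᶜ,
    (IsEsakiaSpace.isClopen_lowerClosure _
      (U.isClopen.diff (⊥ : ClopenUpperSet X).isClopen)).compl⟩,
    (lowerClosure (U \ (⊥ : ClopenUpperSet X) : Set X)).lower.compl⟩
  himp_bot _ := rfl

/-- The preimage of clopen upsets under a Priestley morphism. -/
def preimage (f : X →Co Y) :
    BoundedLatticeHom (ClopenUpperSet Y) (ClopenUpperSet X) where
  toFun U := ⟨⟨f ⁻¹' U, U.isClopen.preimage f.continuous_toFun⟩, U.upper.preimage f.monotone'⟩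
  map_sup' _ _ := rfl
  map_inf' _ _ := rfl
  map_top' := rfl
  map_bot' := rfl

section Point

variable [CompactSpace Y]
  (h : BoundedLatticeHom (ClopenUpperSet Y) (ClopenUpperSet X))

/-- The prime filter of the clopen upsets `U` with `x ∈ h U` consists, by compactness, of the
clopen upsets that contain some point `y`. -/
theorem exists_point (x : X) : ∃ y : Y, ∀ U : ClopenUpperSet Y, y ∈ U ↔ x ∈ h U := by
  -- The sets `U \ V` with `x ∈ h U` and `x ∉ h V` are compact and directed; they are nonempty
  -- because `U ⊆ V` would give `h U ≤ h V`. A point common to all of them is the required one.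
  let ι := {p : ClopenUpperSet Y × ClopenUpperSet Y // x ∈ h p.1 ∧ x ∉ h p.2}
  have hbot : x ∉ h ⊥ := by rw [map_bot]; exact id
  have htop : x ∈ h ⊤ := by rw [map_top]; trivial
  have : Nonempty ι := ⟨⟨(⊤, ⊥), htop, hbot⟩⟩
  have hclopen (p : ι) : IsClopen (p.1.1 \ p.1.2 : Set Y) := p.1.1.isClopen.diff p.1.2.isClopen
  obtain ⟨y, hy⟩ := IsCompact.nonempty_iInter_of_directed_nonempty_isCompact_isClosed
    (fun p : ι => (p.1.1 \ p.1.2 : Set Y))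
    (by
      rintro ⟨⟨U, V⟩, hU, hV⟩ ⟨⟨U', V'⟩, hU', hV'⟩
      refine ⟨⟨(U ⊓ U', V ⊔ V'), ?_, ?_⟩, ?_, ?_⟩
      · rw [map_inf]; exact ⟨hU, hU'⟩
      · rw [map_sup]; exact fun h => h.elim hV hV'
      · exact fun z hz => ⟨hz.1.1, fun h => hz.2 (Or.inl h)⟩
      · exact fun z hz => ⟨hz.1.2, fun h => hz.2 (Or.inr h)⟩)
    (by
      rintro ⟨⟨U, V⟩, hU, hV⟩
      rw [Set.sdiff_nonempty]
      exact fun hUV => hV ((OrderHomClass.mono h (show U ≤ V from hUV) : h U ≤ h V) hU))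
    (fun p => (hclopen p).isClosed.isCompact) (fun p => (hclopen p).isClosed)
  rw [Set.mem_iInter] at hy
  refine ⟨y, fun U => ⟨fun hyU => ?_, fun hxU => (hy ⟨(U, ⊥), hxU, hbot⟩).1⟩⟩
  by_contra hxU
  exact (hy ⟨(⊤, U), htop, hxU⟩).2 hyU

/-- The point of `Y` whose clopen upsets are the `U` with `x ∈ h U`. -/
noncomputable def point (x : X) : Y := (exists_point h x).choose

theorem point_mem_iff {x : X} {U : ClopenUpperSet Y} : point h x ∈ U ↔ x ∈ h U :=
  (exists_point h x).choose_spec U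

variable [PriestleySpace Y]

theorem continuous_point : Continuous (point h) := by
  refine isTopologicalBasis_isClopen.continuous_iff.2 fun C hC => ?_
  refine IsClopen.isOpen ?_
  have hmem := hC.mem_booleanClosure (B := Set.range ((↑) : ClopenUpperSet Y → Set Y))
    (by rintro - ⟨U, rfl⟩; exact U.isClopen) fun y y' hyy' => by
      obtain ⟨U, hU, hU'⟩ := exists_mem_notMem hyy'
      exact ⟨U, ⟨U, rfl⟩, hU, hU'⟩
  clear hC
  induction hmem using BooleanSubalgebra.closure_bot_sup_induction with
  | mem C hC =>
    obtain ⟨U, rfl⟩ := hC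
    convert (h U).isClopen using 1
    exact Set.ext fun x => point_mem_iff h
  | bot => exact isClopen_empty
  | sup C _ D _ hC hD => exact hC.union hD
  | compl C _ hC => exact hC.compl

/-- The Priestley morphism dual to a lattice homomorphism between clopen upsets. -/
noncomputable def pointHom : X →Co Y where
  toFun := point h
  monotone' _ _ hxx' := le_iff_forall_mem.2 fun U hU =>
    (point_mem_iff h).2 ((h U).upper hxx' ((point_mem_iff h).1 hU))
  continuous_toFun := continuous_point h

theorem preimage_pointHom : preimage (pointHom h) = h :=
  BoundedLatticeHom.ext fun _ => SetLike.ext fun _ => point_mem_iff h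

end Point

theorem preimage_injective [PriestleySpace Y] :
    Function.Injective (preimage : (X →Co Y) → _) := by
  intro f g h
  have key (x : X) (U : ClopenUpperSet Y) : f x ∈ U ↔ g x ∈ U :=
    SetLike.ext_iff.1 (DFunLike.congr_fun h U) x
  ext x
  exact le_antisymm (le_iff_forall_mem.2 fun U => (key x U).1)
    (le_iff_forall_mem.2 fun U => (key x U).2)

end ClopenUpperSet

/-- The functor that sends an Esakia space to the Heyting algebra of its clopen upsets. -/
def clopenUpperSetFunctor : ESMinus.{u}ᵒᵖ ⥤ HAMinus.{u} where
  obj X := HeytAlg.of (ClopenUpperSet X.unop.carrier)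
  map f := HAMinus.homOf (ClopenUpperSet.preimage f.unop)

instance : clopenUpperSetFunctor.{u}.Faithful where
  map_injective {X Y _ _} h := Quiver.Hom.unop_inj (ClopenUpperSet.preimage_injective
    (congrArg (fun k : clopenUpperSetFunctor.obj X ⟶ clopenUpperSetFunctor.obj Y => k.hom.hom) h))

instance : clopenUpperSetFunctor.{u}.Full where
  map_surjective {X Y} g := ⟨Quiver.Hom.op (X := Y.unop) (Y := X.unop)
      (ClopenUpperSet.pointHom (X := Y.unop.carrier) (Y := X.unop.carrier) g.hom.hom),
    InducedCategory.hom_ext (BddDistLat.ext fun x =>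
      DFunLike.congr_fun (ClopenUpperSet.preimage_pointHom g.hom.hom) x)⟩

/-! ### The prime spectrum of a bounded distributive lattice -/

/-- The prime filters of a bounded distributive lattice, encoded as their characteristic functions:
the bounded lattice homomorphisms to `Bool`. As a subtype of `A → Bool` it carries the order
of inclusion of filters and the topology of pointwise convergence. -/
abbrev LatticeSpectrum (A : Type*) [DistribLattice A] [BoundedOrder A] : Type _ :=
  {p : A → Bool // p ⊥ = false ∧ p ⊤ = true ∧ (∀ a b, p (a ⊔ b) = (p a || p b)) ∧
    ∀ a b, p (a ⊓ b) = (p a && p b)}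

namespace LatticeSpectrum

variable {A : Type*}

section DistribLattice

variable [DistribLattice A] [BoundedOrder A]

theorem mono (p : LatticeSpectrum A) {a b : A} (hab : a ≤ b) (ha : p.1 a = true) :
    p.1 b = true := by
  have := p.2.2.2.1 a b
  simpa [sup_eq_right.2 hab, ha] using this

theorem le_iff {p q : LatticeSpectrum A} : p ≤ q ↔ ∀ a, p.1 a = true → q.1 a = true :=
  forall_congr' fun _ => Bool.le_iff_imp

/-- The prime filter theorem: a filter disjoint from an ideal extends to a prime filter disjoint
from that ideal. -/
theorem exists_of_disjoint {F : Order.PFilter A} {I : Order.Ideal A}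
    (hFI : Disjoint (F : Set A) I) :
    ∃ p : LatticeSpectrum A, (∀ a ∈ F, p.1 a = true) ∧ ∀ a ∈ I, p.1 a = false := by
  classical
  obtain ⟨J, hJ, hIJ, hFJ⟩ := DistribLattice.prime_ideal_of_disjoint_filter_ideal hFI
  have hinf (a b : A) : a ⊓ b ∈ J ↔ a ∈ J ∨ b ∈ J :=
    ⟨hJ.mem_or_mem, fun h => h.elim (J.lower inf_le_left) (J.lower inf_le_right)⟩
  refine ⟨⟨fun a => decide (a ∉ J), ?_, ?_, ?_, ?_⟩, ?_, ?_⟩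
  · simp
  · simpa using Order.Ideal.isProper_iff_top_notMem.1 hJ.toIsProper
  · intro a b
    simp [Order.Ideal.sup_mem_iff, imp_iff_not_or]
  · intro a b
    simp [hinf]
  · exact fun a ha => by simpa using Set.disjoint_left.1 hFJ ha
  · exact fun a ha => by simpa using hIJ ha

theorem isClopen_setOf_eq_true (a : A) : IsClopen {p : LatticeSpectrum A | p.1 a = true} :=
  (isClopen_discrete {true}).preimage ((continuous_apply a).comp continuous_subtype_val)

instance : CompactSpace (LatticeSpectrum A) := by
  refine isCompact_iff_compactSpace.1 (IsClosed.isCompact ?_)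
  change IsClosed {p : A → Bool | p ⊥ = false ∧ p ⊤ = true ∧
    (∀ a b, p (a ⊔ b) = (p a || p b)) ∧ ∀ a b, p (a ⊓ b) = (p a && p b)}
  simp only [Set.ofPred_and, Set.ofPred_forall]
  have hsup : Continuous fun x : Bool × Bool => x.1 || x.2 :=
    continuous_of_discreteTopology
  have hinf : Continuous fun x : Bool × Bool => x.1 && x.2 :=
    continuous_of_discreteTopology
  refine (isClosed_eq (continuous_apply _) continuous_const).inter
    ((isClosed_eq (continuous_apply _) continuous_const).inter (.inter ?_ ?_))
  · exact isClosed_iInter fun a => isClosed_iInter fun b => isClosed_eq (continuous_apply _)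
      (hsup.comp (f := fun p : A → Bool => (p a, p b))
        ((continuous_apply a).prodMk (continuous_apply b)))
  · exact isClosed_iInter fun a => isClosed_iInter fun b => isClosed_eq (continuous_apply _)
      (hinf.comp (f := fun p : A → Bool => (p a, p b))
        ((continuous_apply a).prodMk (continuous_apply b)))

/-- The clopen upset of the prime filters that contain `a`. -/
def basicClopen (a : A) : ClopenUpperSet (LatticeSpectrum A) :=
  ⟨⟨{p | p.1 a = true}, isClopen_setOf_eq_true a⟩, fun _ _ hpq hp => le_iff.1 hpq a hp⟩

theorem mem_basicClopen {a : A} {p : LatticeSpectrum A} : p ∈ basicClopen a ↔ p.1 a = true :=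
  Iff.rfl

theorem exists_mem_basicClopen_of_not_le {p q : LatticeSpectrum A} (h : ¬p ≤ q) :
    ∃ a, p ∈ basicClopen a ∧ q ∉ basicClopen a := by
  simp only [le_iff, not_forall] at h
  obtain ⟨a, hp, hq⟩ := h
  exact ⟨a, hp, hq⟩

instance : PriestleySpace (LatticeSpectrum A) where
  priestley h := by
    obtain ⟨a, hp, hq⟩ := exists_mem_basicClopen_of_not_le h
    exact ⟨basicClopen a, (basicClopen a).isClopen, (basicClopen a).upper, hp, hq⟩

theorem basicClopen_bot : basicClopen (⊥ : A) = ⊥ :=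
  SetLike.ext fun p => iff_of_false (by simp [mem_basicClopen, p.2.1]) id

theorem basicClopen_top : basicClopen (⊤ : A) = ⊤ :=
  SetLike.ext fun p => iff_of_true p.2.2.1 trivial

theorem basicClopen_sup (a b : A) : basicClopen (a ⊔ b) = basicClopen a ⊔ basicClopen b :=
  SetLike.ext fun p => by
    change p.1 (a ⊔ b) = true ↔ p.1 a = true ∨ p.1 b = true
    simp [p.2.2.2.1]

theorem basicClopen_inf (a b : A) : basicClopen (a ⊓ b) = basicClopen a ⊓ basicClopen b :=
  SetLike.ext fun p => by
    change p.1 (a ⊓ b) = true ↔ p.1 a = true ∧ p.1 b = true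
    simp [p.2.2.2.2]

theorem basicClopen_le_basicClopen {a b : A} : basicClopen a ≤ basicClopen b ↔ a ≤ b := by
  refine ⟨fun h => ?_, fun h p hp => p.mono h hp⟩
  by_contra hab
  obtain ⟨p, hpa, hpb⟩ := exists_of_disjoint (F := .principal a) (I := .principal b)
    (Set.disjoint_left.2 fun c hac hcb => hab (le_trans hac hcb))
  have hb : p.1 b = true := h (show p ∈ basicClopen a from hpa a le_rfl)
  simp [hpb b le_rfl] at hb

theorem isBoundedSublattice_range_basicClopen :
    IsBoundedSublattice (Set.range fun a : A => (basicClopen a : Set (LatticeSpectrum A))) where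
  bot_mem := ⟨⊥, congrArg _ basicClopen_bot⟩
  top_mem := ⟨⊤, congrArg _ basicClopen_top⟩
  sup_mem := by rintro - ⟨a, rfl⟩ - ⟨b, rfl⟩; exact ⟨a ⊔ b, congrArg _ (basicClopen_sup a b)⟩
  inf_mem := by rintro - ⟨a, rfl⟩ - ⟨b, rfl⟩; exact ⟨a ⊓ b, congrArg _ (basicClopen_inf a b)⟩

/-- Each clopen upset of the spectrum is basic, since the basic ones form a sublattice that
separates a point of an upset from the points outside it. -/
theorem basicClopen_surjective :
    Function.Surjective (basicClopen : A → ClopenUpperSet (LatticeSpectrum A)) := by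
  intro U
  obtain ⟨a, ha⟩ := isBoundedSublattice_range_basicClopen.mem_of_isClopen
    (by rintro - ⟨a, rfl⟩; exact (basicClopen a).isClopen) U.isClopen fun p hp q hq => by
      obtain ⟨a, hpa, hqa⟩ := exists_mem_basicClopen_of_not_le fun hpq => hq (U.upper hpq hp)
      exact ⟨_, ⟨a, rfl⟩, hpa, hqa⟩
  exact ⟨a, SetLike.coe_injective ha⟩

/-- A bounded distributive lattice is isomorphic to the clopen upsets of its spectrum. -/
noncomputable def basicClopenOrderIso : A ≃o ClopenUpperSet (LatticeSpectrum A) :=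
  RelIso.ofSurjective (OrderEmbedding.ofMapLEIff basicClopen fun _ _ => basicClopen_le_basicClopen)
    basicClopen_surjective

end DistribLattice

section Heyting

variable [HeytingAlgebra A]

/-- The identity behind the Esakia condition: a prime filter `p` lies below some prime filter that
contains `a` and not `b` exactly when `a ⇨ b` is not in `p`. -/
theorem lowerClosure_basicClopen_diff (a b : A) :
    (lowerClosure (basicClopen a \ basicClopen b : Set (LatticeSpectrum A)) :
      Set (LatticeSpectrum A)) = (basicClopen (a ⇨ b) : Set (LatticeSpectrum A))ᶜ := by
  ext p
  constructor
  · rintro ⟨q, ⟨hqa, hqb⟩, hpq⟩ hp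
    have hq : q ∈ basicClopen (a ⇨ b) := (basicClopen _).upper hpq hp
    have : q ∈ basicClopen (a ⊓ (a ⇨ b)) := by
      rw [basicClopen_inf]; exact ⟨hqa, hq⟩
    exact hqb (basicClopen_le_basicClopen.2 inf_himp_le this)
  · intro hp
    -- The filter generated by `a` and the elements of `p` does not contain `b`.
    have hF : Order.IsPFilter {d : A | ∃ c, p.1 c = true ∧ c ⊓ a ≤ d} := by
      refine .of_def ⟨⊤, ⊤, p.2.2.1, le_top⟩ ?_ ?_
      · rintro d ⟨c, hc, hcd⟩ d' ⟨c', hc', hcd'⟩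
        refine ⟨d ⊓ d', ⟨c ⊓ c', by simp [p.2.2.2.2, hc, hc'], le_inf ?_ ?_⟩,
          inf_le_left, inf_le_right⟩
        · exact (inf_le_inf_right a inf_le_left).trans hcd
        · exact (inf_le_inf_right a inf_le_right).trans hcd'
      · rintro d d' hdd' ⟨c, hc, hcd⟩
        exact ⟨c, hc, hcd.trans hdd'⟩
    obtain ⟨q, hqF, hqb⟩ := exists_of_disjoint (F := hF.toPFilter) (I := .principal b)
      (Set.disjoint_left.2 fun d ⟨c, hc, hcd⟩ hdb =>
        hp (p.mono (le_himp_iff.2 (hcd.trans hdb)) hc))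
    refine ⟨q, ⟨hqF a ⟨⊤, p.2.2.1, inf_le_right⟩, fun hq => ?_⟩,
      le_iff.2 fun c hc => hqF c ⟨c, hc, inf_le_left⟩⟩
    have hq : q.1 b = true := hq
    simp [hqb b le_rfl] at hq

/-- The spectrum of a Heyting algebra is an Esakia space. -/
instance : IsEsakiaSpace (LatticeSpectrum A) where
  isClopen_lowerClosure C hC := by
    have hB := isBoundedSublattice_range_basicClopen (A := A)
    have hmem := hC.mem_booleanClosure
      (B := Set.range fun a : A => (basicClopen a : Set (LatticeSpectrum A)))
      (by rintro - ⟨a, rfl⟩; exact (basicClopen a).isClopen) fun p q hpq => by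
        obtain ⟨a, hp, hq⟩ := exists_mem_basicClopen_of_not_le hpq
        exact ⟨_, ⟨a, rfl⟩, hp, hq⟩
    -- A clopen set is a finite union of differences of basic clopen upsets, and `lowerClosure`
    -- preserves unions.
    refine BooleanSubalgebra.closure_sdiff_sup_induction
      (p := fun C _ => IsClopen (lowerClosure C : Set (LatticeSpectrum A)))
      ⟨fun _ ha _ hb => hB.sup_mem _ ha _ hb, fun _ ha _ hb => hB.inf_mem _ ha _ hb⟩
      hB.bot_mem hB.top_mem ?_ ?_ C hmem
    · rintro - ⟨a, rfl⟩ - ⟨b, rfl⟩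
      have := (basicClopen (a ⇨ b)).isClopen.compl
      rwa [← lowerClosure_basicClopen_diff] at this
    · intro C _ D _ hC hD
      rw [show C ⊔ D = C ∪ D from rfl, lowerClosure_union, LowerSet.coe_sup]
      exact hC.union hD

end Heyting

end LatticeSpectrum

instance : clopenUpperSetFunctor.{u}.EssSurj where
  mem_essImage (A : HeytAlg.{u}) := ⟨.op ⟨LatticeSpectrum A⟩,
    ⟨(HAMinus.isoOfOrderIso (B := HeytAlg.of (ClopenUpperSet (LatticeSpectrum A)))
      LatticeSpectrum.basicClopenOrderIso).symm⟩⟩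

instance : clopenUpperSetFunctor.{u}.IsEquivalence where

/-! ### The equivalences -/

/-- The category of Heyting algebras and bounded lattice homomorphisms is equivalent to the
category of Heyting frames and coherent frame homomorphisms, and both are dually equivalent to the
category of Esakia spaces and Priestley morphisms. -/
theorem theorem3p7 :
    Nonempty (HAMinus.{u} ≌ HeytFrmMinus.{u}) ∧
      Nonempty (HAMinus.{u}ᵒᵖ ≌ ESMinus.{u}) ∧
      Nonempty (HeytFrmMinus.{u}ᵒᵖ ≌ ESMinus.{u}) := by
  let e : HeytFrmMinus.{u} ≌ HAMinus.{u} := compactElementsFunctor.asEquivalence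
  let e' : HAMinus.{u}ᵒᵖ ≌ ESMinus.{u} :=
    clopenUpperSetFunctor.asEquivalence.symm.op.trans (opOpEquivalence _)
  exact ⟨⟨e.symm⟩, ⟨e'⟩, ⟨e.op.trans e'⟩⟩
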